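/- Let $p$ be a prime and let $\mathcal F$ be a saturated fusion system on a finite $p$-group $S$. For $P\le S$ write $H^*(P;\mathbb F_p)=H^*(BP;\mathbb F_p)$, and let $H^*(\mathcal F;\mathbb F_p)\subseteq H^*(S;\mathbb F_p)$ be the subring of $\mathcal F$-stable elements: those $x$ with $\varphi^*(x|_Q)=x|_P$ for all $\mathcal F$-centric subgroups $P,Q\le S$ and all $\varphi\in\mathrm{Hom}_{\mathcal F}(P,Q)$ (that is, the preimage of $\varprojlim_{\mathcal O(\mathcal F^c)}H^*(-;\mathbb F_p)$ in $H^*(S;\mathbb F_p)$). Put $H^{m}(\mathcal F;\mathbb F_p)=H^*(\mathcal F;\mathbb F_p)\cap H^{m}(S;\mathbb F_p)$. For an $n$-dimensional complex representation $\rho$ of $S$, viewed as a homomorphism $S\to U(n)$, let $c_i(\rho)=\rho^*(c_i)\in H^{2i}(S;\mathbb F_p)$, where $\rho^*:H^*(BU(n);\mathbb F_p)\to H^*(S;\mathbb F_p)$ is the induced map and $c_i\in H^{2i}(BU(n);\mathbb F_p)\cong H^{2i}(BU(1)^n;\mathbb F_p)^{\Sigma_n}$ is the universal Chern class, corresponding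 to the $i$-th elementary symmetric polynomial in the generators $x_1,\dots,x_n$ of $H^*(BU(1)^n;\mathbb F_p)=\mathbb F_p[x_1,\dots,x_n]$. Call $\rho$ $\mathcal F$-fusion-preserving if for all $P\le S$ and $\varphi\in\mathrm{Hom}_{\mathcal F}(P,S)$ the representations $\rho|_P$ and $\rho\circ\varphi$ of $P$ are isomorphic. Let the Chern subring $\mathrm{Ch}(\mathcal F)$ be the subring of $H^*(S;\mathbb F_p)$ generated by the classes $c_i(\rho)$ for all $i$ and all $\mathcal F$-fusion-preserving finite-dimensional complex representations $\rho$ of $S$. Then for every $\mathcal F$-fusion-preserving finite-dimensional complex representation $\rho$ of $S$ and every $i$, we have $c_i(\rho)\in H^{2i}(\mathcal F;\mathbb F_p)$. Consequently $\mathrm{Ch}(\mathcal F)$ is a subring of $H^*(\mathcal F;\mathbb F_p)$; moreover every $x\in\mathrm{Ch}(\mathcal F)$ satisfies $\varphi^*(x|_Q)=x|_P$ for all $P,Q\le S$ and all $\varphi\in\mathrm{Hom}_{\mathcal F}(P,Q)$. -/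

import Mathlib

open CategoryTheory Opposite
open scoped Simplicial

/-! ### The cohomology ring of a simplicial set -/

/-- Families of cochains: a function `f n : X_n → k` for every degree `n`. -/
structure Cochain (X : SSet.{0}) (k : Type) where
  /-- the component in degree `n` -/
  toFun : (n : ℕ) → X _⦋n⦌ → k

namespace Cochain

instance {X : SSet.{0}} {k : Type} : CoeFun (Cochain X k) fun _ => (n : ℕ) → X _⦋n⦌ → k :=
  ⟨Cochain.toFun⟩

@[ext] theorem ext {X : SSet.{0}} {k : Type} {f g : Cochain X k} (h : ∀ n x, f n x = g n x) :
    f = g := by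
  cases f; cases g
  exact congrArg _ (funext fun n => funext fun x => h n x)

variable {X Y : SSet.{0}} {k : Type} [CommRing k]

instance : Zero (Cochain X k) := ⟨⟨fun _ _ => 0⟩⟩
instance : Add (Cochain X k) := ⟨fun f g => ⟨fun n x => f n x + g n x⟩⟩
instance : Neg (Cochain X k) := ⟨fun f => ⟨fun n x => - f n x⟩⟩
instance : Sub (Cochain X k) := ⟨fun f g => ⟨fun n x => f n x - g n x⟩⟩

@[simp] theorem add_apply (f g : Cochain X k) (n : ℕ) (x : X _⦋n⦌) :
    (f + g) n x = f n x + g n x := rfl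

@[simp] theorem sub_apply (f g : Cochain X k) (n : ℕ) (x : X _⦋n⦌) :
    (f - g) n x = f n x - g n x := rfl

@[simp] theorem neg_apply (f : Cochain X k) (n : ℕ) (x : X _⦋n⦌) :
    (-f) n x = - f n x := rfl

@[simp] theorem zero_apply (n : ℕ) (x : X _⦋n⦌) : (0 : Cochain X k) n x = 0 := rfl

instance : AddCommGroup (Cochain X k) where
  add_assoc f g h := by ext n x; simp [add_assoc]
  zero_add f := by ext n x; simp
  add_zero f := by ext n x; simp
  add_comm f g := by ext n x; simp [add_comm]
  neg_add_cancel f := by ext n x; simp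
  sub_eq_add_neg f g := by ext n x; simp [sub_eq_add_neg]
  nsmul := nsmulRec
  zsmul := zsmulRec

/-- The front face `⦋a⦌ ⟶ ⦋n⦌`, `j ↦ j` (for `a ≤ n`). -/
def front (a n : ℕ) : ⦋a⦌ ⟶ ⦋n⦌ :=
  SimplexCategory.mkHom ⟨fun j => ⟨min j n, by omega⟩, fun i j h => by
    simp only [Fin.le_def] at *; omega⟩

/-- The back face `⦋b⦌ ⟶ ⦋n⦌`, `j ↦ (n - b) + j` (for `b ≤ n`). -/
def back (b n : ℕ) : ⦋b⦌ ⟶ ⦋n⦌ :=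
  SimplexCategory.mkHom ⟨fun j => ⟨min (n - b + j) n, by omega⟩, fun i j h => by
    simp only [Fin.le_def] at *; omega⟩

@[simp] theorem front_val (a n : ℕ) (j : Fin (a + 1)) :
    ((front a n).toOrderHom j : ℕ) = min (j : ℕ) n := rfl

@[simp] theorem back_val (b n : ℕ) (j : Fin (b + 1)) :
    ((back b n).toOrderHom j : ℕ) = min (n - b + j) n := rfl

theorem hom_ext' {a n : ℕ} (f g : ⦋a⦌ ⟶ ⦋n⦌)
    (h : ∀ j : Fin (a + 1), (f.toOrderHom j : ℕ) = (g.toOrderHom j : ℕ)) : f = g := by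
  apply SimplexCategory.Hom.ext
  ext j
  exact h j

theorem comp_val {a b c : ℕ} (f : ⦋a⦌ ⟶ ⦋b⦌) (g : ⦋b⦌ ⟶ ⦋c⦌) (j : Fin (a + 1)) :
    (f ≫ g).toOrderHom j = g.toOrderHom (f.toOrderHom j) := rfl

theorem δ_val {n : ℕ} (i : Fin (n + 2)) (j : Fin (n + 1)) :
    ((SimplexCategory.δ i).toOrderHom j : ℕ) = if (j : ℕ) < i then (j : ℕ) else j + 1 := by
  change ((i.succAbove j : Fin (n + 2)) : ℕ) = _
  simp only [Fin.succAbove, Fin.lt_def, Fin.val_castSucc]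
  split_ifs <;> simp

theorem map_map {a b c : ℕ} (f : ⦋a⦌ ⟶ ⦋b⦌) (g : ⦋b⦌ ⟶ ⦋c⦌) (x : X _⦋c⦌) :
    X.map f.op (X.map g.op x) = X.map (f ≫ g).op x := by
  rw [op_comp, Functor.map_comp_apply]

/-- The cup product (Alexander-Whitney). -/
noncomputable instance : Mul (Cochain X k) where
  mul f g := ⟨fun n x => ∑ ab ∈ Finset.HasAntidiagonal.antidiagonal n,
    f ab.1 (X.map (front ab.1 n).op x) * g ab.2 (X.map (back ab.2 n).op x)⟩

theorem mul_apply (f g : Cochain X k) (n : ℕ) (x : X _⦋n⦌) :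
    (f * g) n x = ∑ ab ∈ Finset.HasAntidiagonal.antidiagonal n,
      f ab.1 (X.map (front ab.1 n).op x) * g ab.2 (X.map (back ab.2 n).op x) := rfl

/-- The unit cochain: `1` on every vertex, `0` in positive degrees. -/
noncomputable instance : One (Cochain X k) where
  one := ⟨fun n _ => if n = 0 then 1 else 0⟩

theorem one_apply (n : ℕ) (x : X _⦋n⦌) : (1 : Cochain X k) n x = if n = 0 then 1 else 0 := rfl

theorem front_self (n : ℕ) : front n n = 𝟙 _ := hom_ext' _ _ fun j => by
  have := j.2
  simp; omega

theorem back_self (n : ℕ) : back n n = 𝟙 _ := hom_ext' _ _ fun j => by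
  have := j.2
  simp; omega

noncomputable instance : Ring (Cochain X k) :=
  { (inferInstance : AddCommGroup (Cochain X k)),
    (inferInstance : Mul (Cochain X k)),
    (inferInstance : One (Cochain X k)) with
    left_distrib := fun f g h => by
      ext n x
      simp only [mul_apply, add_apply, mul_add, Finset.sum_add_distrib]
    right_distrib := fun f g h => by
      ext n x
      simp only [mul_apply, add_apply, add_mul, Finset.sum_add_distrib]
    zero_mul := fun f => by ext n x; simp [mul_apply]
    mul_zero := fun f => by ext n x; simp [mul_apply]
    one_mul := fun f => by
      ext n x
      rw [mul_apply, Finset.sum_eq_single (0, n)]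
      · simp [one_apply, back_self]
      · rintro ⟨a, b⟩ h hne
        have : a ≠ 0 := by
          rintro rfl
          simp at h
          exact hne (by simp [h])
        simp [one_apply, this]
      · intro h; simp at h
    mul_one := fun f => by
      ext n x
      rw [mul_apply, Finset.sum_eq_single (n, 0)]
      · simp [one_apply, front_self]
      · rintro ⟨a, b⟩ h hne
        have : b ≠ 0 := by
          rintro rfl
          simp at h
          exact hne (by simp [h])
        simp [one_apply, this]
      · intro h; simp at h
    mul_assoc := fun f g h => by
      ext n x
      simp only [mul_apply, Finset.sum_mul, Finset.mul_sum, Finset.sum_sigma']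
      refine Finset.sum_nbij' (fun t => ⟨(t.2.1, t.2.2 + t.1.2), (t.2.2, t.1.2)⟩)
        (fun t => ⟨(t.1.1 + t.2.1, t.2.2), (t.1.1, t.2.1)⟩) ?_ ?_ ?_ ?_ ?_
      · rintro ⟨⟨a, b⟩, ⟨c, d⟩⟩ ht
        simp at ht ⊢
        omega
      · rintro ⟨⟨a, b⟩, ⟨c, d⟩⟩ ht
        simp at ht ⊢
        omega
      · rintro ⟨⟨a, b⟩, ⟨c, d⟩⟩ ht
        simp at ht ⊢
        omega
      · rintro ⟨⟨a, b⟩, ⟨c, d⟩⟩ ht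
        simp at ht ⊢
        omega
      · rintro ⟨⟨a, b⟩, ⟨c, d⟩⟩ ht
        simp at ht
        obtain ⟨h1, h2⟩ := ht
        simp only [map_map]
        have e1 : front c a ≫ front a n = front c n := hom_ext' _ _ fun j => by
          have := j.2
          simp only [comp_val, front_val]; omega
        have e2 : back d a ≫ front a n = front d (d + b) ≫ back (d + b) n :=
          hom_ext' _ _ fun j => by
            have := j.2
            simp only [comp_val, front_val, back_val]; omega
        have e3 : back b n = back b (d + b) ≫ back (d + b) n := hom_ext' _ _ fun j => by
            have := j.2
            simp only [comp_val, back_val]; omega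
        rw [e1, e2, ← e3, mul_assoc] }

/-- The coboundary `(d f)(x) = ∑ i, (-1)^i f(∂_i x)`. -/
noncomputable def d : Cochain X k →+ Cochain X k where
  toFun f := ⟨fun n => match n with
    | 0 => fun _ => 0
    | m + 1 => fun x => ∑ i : Fin (m + 2), (-1) ^ (i : ℕ) * f m (X.δ i x)⟩
  map_zero' := by
    ext n x
    cases n <;> simp
  map_add' f g := by
    ext n x
    cases n <;> simp [mul_add, Finset.sum_add_distrib]

@[simp] theorem d_zero (f : Cochain X k) (x : X _⦋0⦌) : d f 0 x = 0 := rfl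

theorem d_succ (f : Cochain X k) (m : ℕ) (x : X _⦋m + 1⦌) :
    d f (m + 1) x = ∑ i : Fin (m + 2), (-1) ^ (i : ℕ) * f m (X.δ i x) := rfl

/-- The sign operator, multiplication by `(-1)^n` in degree `n`. -/
def sgn (f : Cochain X k) : Cochain X k := ⟨fun n x => (-1) ^ n * f n x⟩

@[simp] theorem sgn_apply (f : Cochain X k) (n : ℕ) (x : X _⦋n⦌) :
    sgn f n x = (-1) ^ n * f n x := rfl

theorem sgn_sgn (f : Cochain X k) : sgn (sgn f) = f := by
  ext n x
  simp [← mul_assoc, ← pow_add, ← two_mul]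

theorem d_sgn (f : Cochain X k) : d (sgn f) = - sgn (d f) := by
  ext n x
  cases n with
  | zero => simp
  | succ m =>
    simp only [d_succ, neg_apply, sgn_apply, Finset.mul_sum, ← Finset.sum_neg_distrib]
    exact Finset.sum_congr rfl fun i _ => by ring

theorem δ_eq {m : ℕ} (i : Fin (m + 2)) (x : X _⦋m + 1⦌) :
    X.δ i x = X.map (SimplexCategory.δ i).op x := rfl

/-- The Leibniz rule. -/
theorem d_mul (f g : Cochain X k) : d (f * g) = d f * g + sgn f * d g := by
  ext n x
  cases n with
  | zero => simp [mul_apply]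
  | succ n =>
    have hδ : ∀ {m : ℕ} (i : Fin (m + 2)) (x : X _⦋m + 1⦌),
      X.δ i x = X.map (SimplexCategory.δ i).op x := fun _ _ => rfl
    rw [add_apply, mul_apply, mul_apply, Finset.Nat.sum_antidiagonal_succ,
      Finset.Nat.sum_antidiagonal_succ']
    simp only [d_zero, zero_mul, mul_zero, zero_add]
    simp only [d_succ, mul_apply, Finset.mul_sum, Finset.sum_mul]
    rw [Finset.sum_comm, ← Finset.sum_add_distrib]
    refine Finset.sum_congr rfl ?_
    rintro ⟨a, b⟩ hab
    replace hab : a + b = n := Finset.HasAntidiagonal.mem_antidiagonal.1 hab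
    subst hab
    simp only [hδ, map_map, sgn_apply]
    rw [Fin.sum_univ_castSucc (n := a + 1), Fin.sum_univ_succ (n := b + 1)]
    have split : ∀ F : ℕ → k, ∑ i : Fin (a + b + 2), F i =
        ∑ i : Fin (a + 1), F i + ∑ j : Fin (b + 1), F (a + 1 + j) := by
      intro F
      rw [Fin.sum_univ_eq_sum_range F, Fin.sum_univ_eq_sum_range F,
        Fin.sum_univ_eq_sum_range (fun j => F (a + 1 + j)), show a + b + 2 = (a + 1) + (b + 1) by
          omega, Finset.sum_range_add]
    let F : ℕ → k := fun i => if h : i < a + b + 2 then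
      (-1) ^ i * (f a (X.map (front a (a + b) ≫ SimplexCategory.δ ⟨i, h⟩).op x) *
        g b (X.map (back b (a + b) ≫ SimplexCategory.δ ⟨i, h⟩).op x)) else 0
    have hF : ∀ i : Fin (a + b + 2), F i =
        (-1) ^ (i : ℕ) * (f a (X.map (front a (a + b) ≫ SimplexCategory.δ i).op x) *
          g b (X.map (back b (a + b) ≫ SimplexCategory.δ i).op x)) := fun i => by
      simp [F, i.2]
    rw [← Finset.sum_congr rfl (fun i _ => hF i), split]
    have e1 : ∀ i : Fin (a + 1), F i = (-1) ^ (i.castSucc : ℕ) *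
        f a (X.map (SimplexCategory.δ i.castSucc ≫ front (a + 1) (a + b + 1)).op x) *
          g b (X.map (back b (a + b + 1)).op x) := fun i => by
      have hi : (i : ℕ) < a + b + 2 := by omega
      have h1 : front a (a + b) ≫ SimplexCategory.δ ⟨i, hi⟩ =
          SimplexCategory.δ i.castSucc ≫ front (a + 1) (a + b + 1) := hom_ext' _ _ fun j => by
        have := j.2
        simp only [comp_val, front_val, δ_val, Fin.val_castSucc]; grind
      have h2 : back b (a + b) ≫ SimplexCategory.δ ⟨i, hi⟩ = back b (a + b + 1) :=
        hom_ext' _ _ fun j => by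
        have := j.2
        simp only [comp_val, back_val, δ_val]; grind
      simp only [F, dif_pos hi, h1, h2, Fin.val_castSucc, mul_assoc]
    have e2 : ∀ j : Fin (b + 1), F (a + 1 + j) = (-1) ^ a *
        f a (X.map (front a (a + b + 1)).op x) * ((-1) ^ (j.succ : ℕ) *
          g b (X.map (SimplexCategory.δ j.succ ≫ back (b + 1) (a + b + 1)).op x)) := fun j => by
      have hi : a + 1 + (j : ℕ) < a + b + 2 := by omega
      have h1 : front a (a + b) ≫ SimplexCategory.δ ⟨a + 1 + j, hi⟩ =
          front a (a + b + 1) := hom_ext' _ _ fun j => by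
        have := j.2
        simp only [comp_val, front_val, δ_val]; grind
      have h2 : back b (a + b) ≫ SimplexCategory.δ ⟨a + 1 + j, hi⟩ =
          SimplexCategory.δ j.succ ≫ back (b + 1) (a + b + 1) :=
        hom_ext' _ _ fun j => by
        have := j.2
        simp only [comp_val, back_val, δ_val, Fin.val_succ]; grind
      simp only [F, dif_pos hi, h1, h2, Fin.val_succ]
      ring
    have e3 : SimplexCategory.δ (Fin.last (a + 1)) ≫ front (a + 1) (a + b + 1) =
        front a (a + b + 1) := hom_ext' _ _ fun j => by
      have := j.2
      simp only [comp_val, front_val, δ_val, Fin.val_last]; grind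
    have e4 : SimplexCategory.δ 0 ≫ back (b + 1) (a + b + 1) =
        back b (a + b + 1) := hom_ext' _ _ fun j => by
      have := j.2
      simp only [comp_val, back_val, δ_val, Fin.val_zero]; grind
    rw [Finset.sum_congr rfl fun i _ => e1 i, Finset.sum_congr rfl fun i _ => e2 i, e3, e4]
    simp only [Fin.val_last, Fin.val_zero]
    ring

/-- Cochains that vanish in all large degrees, i.e. elements of `⨁ n, C^n(X; k)`. -/
def IsFinite (f : Cochain X k) : Prop := ∃ N : ℕ, ∀ n, N ≤ n → ∀ x, f n x = 0

theorem IsFinite.add {f g : Cochain X k} (hf : f.IsFinite) (hg : g.IsFinite) :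
    (f + g).IsFinite := by
  obtain ⟨N, hN⟩ := hf
  obtain ⟨M, hM⟩ := hg
  exact ⟨max N M, fun n hn x => by
    rw [add_apply, hN n (le_trans (le_max_left _ _) hn), hM n (le_trans (le_max_right _ _) hn),
      add_zero]⟩

theorem IsFinite.neg {f : Cochain X k} (hf : f.IsFinite) : (-f).IsFinite := by
  obtain ⟨N, hN⟩ := hf
  exact ⟨N, fun n hn x => by rw [neg_apply, hN n hn, neg_zero]⟩

theorem isFinite_zero : (0 : Cochain X k).IsFinite := ⟨0, fun _ _ _ => rfl⟩

theorem IsFinite.sgn {f : Cochain X k} (hf : f.IsFinite) : f.sgn.IsFinite := by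
  obtain ⟨N, hN⟩ := hf
  exact ⟨N, fun n hn x => by rw [sgn_apply, hN n hn, mul_zero]⟩

theorem IsFinite.mul {f g : Cochain X k} (hf : f.IsFinite) (hg : g.IsFinite) :
    (f * g).IsFinite := by
  obtain ⟨N, hN⟩ := hf
  obtain ⟨M, hM⟩ := hg
  refine ⟨N + M, fun n hn x => ?_⟩
  rw [mul_apply]
  refine Finset.sum_eq_zero ?_
  rintro ⟨a, b⟩ h
  replace h : a + b = n := Finset.HasAntidiagonal.mem_antidiagonal.1 h
  by_cases ha : N ≤ a
  · simp [hN a ha]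
  · simp [hM b (by omega)]

theorem d_one : d (1 : Cochain X k) = 0 := by
  have h := d_mul (1 : Cochain X k) 1
  have hs : sgn (1 : Cochain X k) = 1 := by
    ext n x
    by_cases hn : n = 0 <;> simp [one_apply, hn]
  rw [hs, one_mul, mul_one, one_mul] at h
  simpa using h

/-- The ring of cocycles in `⨁ n, C^n(X; k)`. -/
noncomputable def cocycles (X : SSet.{0}) (k : Type) [CommRing k] : Subring (Cochain X k) where
  carrier := {f | d f = 0 ∧ f.IsFinite}
  zero_mem' := ⟨map_zero _, isFinite_zero⟩
  one_mem' := ⟨d_one, 1, fun n hn x => by rw [one_apply, if_neg (by omega)]⟩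
  add_mem' := fun hf hg => ⟨by rw [map_add, hf.1, hg.1, add_zero], hf.2.add hg.2⟩
  neg_mem' := fun hf => ⟨by rw [map_neg, hf.1, neg_zero], hf.2.neg⟩
  mul_mem' := fun hf hg => ⟨by rw [d_mul, hf.1, hg.1, zero_mul, mul_zero, add_zero],
    hf.2.mul hg.2⟩

/-- The relation "`z - w` is a coboundary" on cocycles. -/
noncomputable def cobRel (X : SSet.{0}) (k : Type) [CommRing k] : RingCon (cocycles X k) where
  r z w := ∃ g : Cochain X k, g.IsFinite ∧ d g = z.1 - w.1
  iseqv := ⟨fun z => ⟨0, isFinite_zero, by simp⟩,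
    fun ⟨g, hg, h⟩ => ⟨-g, hg.neg, by rw [map_neg, h, neg_sub]⟩,
    fun ⟨g, hg, h⟩ ⟨g', hg', h'⟩ => ⟨g + g', hg.add hg', by
      rw [map_add, h, h', sub_add_sub_cancel]⟩⟩
  add' := fun {w x y z} ⟨g, hg, h⟩ ⟨g', hg', h'⟩ => ⟨g + g', hg.add hg', by
    rw [map_add, h, h', Subring.coe_add, Subring.coe_add]; abel⟩
  mul' := fun {w x y z} ⟨g, hg, h⟩ ⟨g', hg', h'⟩ =>
    ⟨g * y.1 + sgn x.1 * g', (hg.mul y.2.2).add (x.2.2.sgn.mul hg'), by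
      rw [map_add, d_mul, d_mul, d_sgn, sgn_sgn, h, h', y.2.1, x.2.1, Subring.coe_mul,
        Subring.coe_mul, show sgn (0 : Cochain X k) = 0 by ext n x; simp]
      simp only [mul_zero, neg_zero, zero_mul, add_zero, zero_add]
      noncomm_ring⟩

/-- Pullback of cochains along a simplicial map. -/
noncomputable def comap (k : Type) [CommRing k] (φ : X ⟶ Y) : Cochain Y k →+* Cochain X k where
  toFun f := ⟨fun n x => f n (φ.app _ x)⟩
  map_zero' := rfl
  map_one' := rfl
  map_add' _ _ := rfl
  map_mul' f g := by
    ext n x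
    rw [mul_apply]
    change ∑ ab ∈ Finset.HasAntidiagonal.antidiagonal n, _ =
      ∑ ab ∈ Finset.HasAntidiagonal.antidiagonal n,
        f ab.1 (φ.app _ (X.map _ x)) * g ab.2 (φ.app _ (X.map _ x))
    simp only [NatTrans.naturality_apply]

theorem d_comap (φ : X ⟶ Y) (f : Cochain Y k) : d (comap k φ f) = comap k φ (d f) := by
  ext n x
  cases n with
  | zero => rfl
  | succ m =>
    change ∑ i : Fin (m + 2), (-1) ^ (i : ℕ) * f m (φ.app _ (X.map _ x)) =
      ∑ i : Fin (m + 2), (-1) ^ (i : ℕ) * f m (Y.map _ (φ.app _ x))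
    simp only [NatTrans.naturality_apply]

theorem IsFinite.comap (φ : X ⟶ Y) {f : Cochain Y k} (hf : f.IsFinite) :
    (Cochain.comap k φ f).IsFinite := by
  obtain ⟨N, hN⟩ := hf
  exact ⟨N, fun n hn x => hN n hn _⟩

/-- Pullback of cocycles along a simplicial map. -/
noncomputable def comapCocycles (k : Type) [CommRing k] (φ : X ⟶ Y) :
    cocycles Y k →+* cocycles X k :=
  ((comap k φ).comp (cocycles Y k).subtype).codRestrict (cocycles X k) fun z =>
    ⟨by
      rw [RingHom.comp_apply, d_comap, Subring.subtype_apply, z.2.1, map_zero], z.2.2.comap φ⟩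

end Cochain

/-- The cohomology ring `H^*(X; k) = ⨁ n, H^n(X; k)` with the cup product. -/
abbrev Cohomology (X : SSet.{0}) (k : Type) [CommRing k] : Type :=
  (Cochain.cobRel X k).Quotient

namespace Cohomology

variable {X Y : SSet.{0}} {k : Type} [CommRing k]

/-- The class of a cocycle. -/
noncomputable def mk : Cochain.cocycles X k →+* Cohomology X k := (Cochain.cobRel X k).mk'

/-- The degree `n` part `H^n(X; k)` of `H^*(X; k)`. -/
noncomputable def degree (X : SSet.{0}) (k : Type) [CommRing k] (n : ℕ) :
    AddSubgroup (Cohomology X k) :=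
  AddSubgroup.map (mk (X := X) (k := k)).toAddMonoidHom
    { carrier := {z | ∀ m, m ≠ n → ∀ x, z.1 m x = 0}
      zero_mem' := fun _ _ _ => rfl
      add_mem' := fun {a b} ha hb m hm x => by
        rw [Subring.coe_add, Cochain.add_apply, ha m hm, hb m hm, add_zero]
      neg_mem' := fun {a} ha m hm x => by
        rw [Subring.coe_neg, Cochain.neg_apply, ha m hm, neg_zero] }

/-- The ring homomorphism `H^*(Y; k) → H^*(X; k)` induced by a simplicial map `X ⟶ Y`. -/
noncomputable def map (k : Type) [CommRing k] (φ : X ⟶ Y) : Cohomology Y k →+* Cohomology X k :=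
  (Cochain.cobRel Y k).lift (mk.comp (Cochain.comapCocycles k φ)) fun z w h => by
    obtain ⟨g, hg, hd⟩ := h
    refine (RingCon.eq _).2 ⟨Cochain.comap k φ g, hg.comap φ, ?_⟩
    rw [Cochain.d_comap, hd, map_sub]
    rfl

end Cohomology

/-! ### Classifying spaces of topological groups -/

/-- Precomposition of singular simplices `Δ^n → G` with the map `Δ^m → Δ^n` induced by
`θ : ⦋m⦌ ⟶ ⦋n⦌`, a group homomorphism for the pointwise multiplication. -/
noncomputable def singMap (G : Type) [Group G] [TopologicalSpace G] [IsTopologicalGroup G]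
    {m n : SimplexCategory} (θ : m ⟶ n) :
    C(stdSimplex ℝ (Fin (n.len + 1)), G) →* C(stdSimplex ℝ (Fin (m.len + 1)), G) where
  toFun σ := σ.comp ⟨stdSimplex.map θ.toOrderHom, stdSimplex.continuous_map _⟩
  map_one' := rfl
  map_mul' _ _ := rfl

theorem singMap_id (G : Type) [Group G] [TopologicalSpace G] [IsTopologicalGroup G]
    {n : SimplexCategory} (σ : C(stdSimplex ℝ (Fin (n.len + 1)), G)) : singMap G (𝟙 n) σ = σ :=
  ContinuousMap.ext fun t => congrArg σ (stdSimplex.map_id_apply t)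

theorem singMap_comp (G : Type) [Group G] [TopologicalSpace G] [IsTopologicalGroup G]
    {l m n : SimplexCategory} (η : l ⟶ m) (θ : m ⟶ n)
    (σ : C(stdSimplex ℝ (Fin (n.len + 1)), G)) :
    singMap G (η ≫ θ) σ = singMap G η (singMap G θ σ) :=
  ContinuousMap.ext fun t =>
    congrArg σ (stdSimplex.map_comp_apply η.toOrderHom θ.toOrderHom t).symm

/-- The classifying space of a topological group `G`, as a simplicial set: the quotient of the
contractible simplicial set `EG`, with `n`-simplices the tuples `(σ_0, …, σ_n)` of continuous maps
`σ_i : Δ^n → G`, by the free left action of the simplicial group `n ↦ C(Δ^n, G)`. This is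
the diagonal of the nerve of the singular simplicial group of `G`; for discrete `G` it is
the nerve of `G`. -/
noncomputable def BSpace (G : Type) [Group G] [TopologicalSpace G] [IsTopologicalGroup G] :
    SSet.{0} where
  obj n := MulAction.orbitRel.Quotient C(stdSimplex ℝ (Fin (n.unop.len + 1)), G)
    (Fin (n.unop.len + 1) → C(stdSimplex ℝ (Fin (n.unop.len + 1)), G))
  map {n m} θ := ↾(Quotient.map (fun σ i => singMap G θ.unop (σ (θ.unop.toOrderHom i))) (by
    rintro _ σ ⟨γ, rfl⟩
    exact ⟨singMap G θ.unop γ, funext fun i => ((singMap G θ.unop).map_mul _ _).symm⟩))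
  map_id n := by
    ext x
    induction x using Quotient.inductionOn with | _ σ
    exact congrArg (Quotient.mk _) (funext fun i => singMap_id G (σ i))
  map_comp {a b c} θ η := by
    ext x
    induction x using Quotient.inductionOn with | _ σ
    exact congrArg (Quotient.mk _) (funext fun i => singMap_comp G η.unop θ.unop _)

/-- The map `BG → BH` induced by a continuous group homomorphism. -/
noncomputable def BSpace.map {G H : Type} [Group G] [TopologicalSpace G] [IsTopologicalGroup G]
    [Group H] [TopologicalSpace H] [IsTopologicalGroup H] (f : G →ₜ* H) :
    BSpace G ⟶ BSpace H where
  app n := ↾(Quotient.map (fun σ i => f.toContinuousMap.comp (σ i)) (by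
    rintro _ σ ⟨γ, rfl⟩
    exact ⟨f.toContinuousMap.comp γ, funext fun i => ContinuousMap.ext fun t =>
      (map_mul f (γ t) (σ i t)).symm⟩))
  naturality {n m} θ := by
    ext x
    induction x using Quotient.inductionOn with | _ σ
    rfl

/-- A homomorphism from a discrete group is continuous. -/
def MonoidHom.toContinuousOfDiscrete {G H : Type} [Group G] [TopologicalSpace G]
    [DiscreteTopology G] [Group H] [TopologicalSpace H] (f : G →* H) : G →ₜ* H :=
  ⟨f, continuous_of_discreteTopology⟩

/-! ### Universal Chern classes -/

/-- The loop `Δ^1 → U(1)`, `(t_0, t_1) ↦ exp(2πi t_1)`, composed with the degeneracy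
`Δ^2 → Δ^1`, `(t_0, t_1, t_2) ↦ (t_0, t_1 + t_2)`. -/
noncomputable def loopA : C(stdSimplex ℝ (Fin 3), Circle) :=
  ⟨fun t => Circle.exp (2 * Real.pi * (t.1 1 + t.1 2)),
    Circle.exp.continuous.comp (continuous_const.mul
      (((continuous_apply 1).comp continuous_subtype_val).add
        ((continuous_apply 2).comp continuous_subtype_val)))⟩

/-- The same loop composed with the degeneracy `Δ^2 → Δ^1`,
`(t_0, t_1, t_2) ↦ (t_0 + t_1, t_2)`. -/
noncomputable def loopB : C(stdSimplex ℝ (Fin 3), Circle) :=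
  ⟨fun t => Circle.exp (2 * Real.pi * t.1 2),
    Circle.exp.continuous.comp (continuous_const.mul
      ((continuous_apply 2).comp continuous_subtype_val))⟩

/-- The 2-simplex `[(1, 1, loopA)]` of `BU(1)`. -/
noncomputable def simplexA : (BSpace Circle) _⦋2⦌ :=
  Quotient.mk _ (![1, 1, loopA] : Fin 3 → C(stdSimplex ℝ (Fin 3), Circle))

/-- The 2-simplex `[(1, loopB, loopB)]` of `BU(1)`. -/
noncomputable def simplexB : (BSpace Circle) _⦋2⦌ :=
  Quotient.mk _ (![1, loopB, loopB] : Fin 3 → C(stdSimplex ℝ (Fin 3), Circle))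

/-- `x` is the canonical generator of `H^2(BU(1); k)`: it takes the value `1` on the
fundamental class of the 2-sphere `ΣU(1) ⊆ BU(1)`, which is represented by the cycle
`simplexA - simplexB` and generates `H_2(BU(1); ℤ) = ℤ`. -/
def IsCanonicalGenerator (k : Type) [CommRing k] (x : Cohomology (BSpace Circle) k) : Prop :=
  ∃ z : Cochain.cocycles (BSpace Circle) k, Cohomology.mk z = x ∧
    (∀ m, m ≠ 2 → ∀ s, z.1 m s = 0) ∧ z.1 2 simplexA - z.1 2 simplexB = 1

/-- The unitary group `U(n)`. -/
abbrev U (n : ℕ) : Type := Matrix.unitaryGroup (Fin n) ℂ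

/-- The torus `T^n = U(1)^n`. -/
abbrev Torus (n : ℕ) : Type := Fin n → Circle

/-- The inclusion of the diagonal matrices `T^n → U(n)`. -/
noncomputable def torusInclusion (n : ℕ) : Torus n →ₜ* U n where
  toFun t := ⟨Matrix.diagonal fun j => (t j : ℂ), by
    rw [Matrix.mem_unitaryGroup_iff, Matrix.star_eq_conjTranspose,
      Matrix.diagonal_conjTranspose, Matrix.diagonal_mul_diagonal, ← Matrix.diagonal_one]
    congr 1
    ext j
    simp [Complex.mul_conj]⟩
  map_one' := by
    ext i j
    simp [Matrix.one_apply, Matrix.diagonal_apply]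
  map_mul' s t := by
    apply Subtype.ext
    simp [Matrix.diagonal_mul_diagonal]
  continuous_toFun := Continuous.subtype_mk
    (Continuous.matrix_diagonal (continuous_pi fun j =>
      continuous_subtype_val.comp (continuous_apply j))) _

/-- The projection `T^n → U(1)` to the `j`-th factor. -/
def torusProj (n : ℕ) (j : Fin n) : Torus n →ₜ* Circle where
  toFun t := t j
  map_one' := rfl
  map_mul' _ _ := rfl
  continuous_toFun := continuous_apply j

/-- The `i`-th elementary symmetric polynomial in `x_1, …, x_n` (products are
taken in increasing order, the elements need not be assumed to commute). -/
def elemSymm {R : Type} [Ring R] {n : ℕ} (i : ℕ) (x : Fin n → R) : R :=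
  ∑ s ∈ (Finset.univ : Finset (Fin n)).powersetCard i, ((s.sort).map x).prod

/-- `c` is the universal Chern class `c_i ∈ H^{2i}(BU(n); k)`: under the restriction
`H^*(BU(n); k) → H^*(BT^n; k) = k[x_1, …, x_n]`, an isomorphism
onto the symmetric polynomials, it corresponds to the `i`-th elementary symmetric polynomial. -/
def IsUniversalChernClass (k : Type) [CommRing k] (n i : ℕ) (c : Cohomology (BSpace (U n)) k) :
    Prop :=
  c ∈ Cohomology.degree (BSpace (U n)) k (2 * i) ∧
    ∃ x : Cohomology (BSpace Circle) k, IsCanonicalGenerator k x ∧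
      Cohomology.map k (BSpace.map (torusInclusion n)) c =
        elemSymm i fun j => Cohomology.map k (BSpace.map (torusProj n j)) x

open Classical in
/-- The universal Chern class `c_i ∈ H^{2i}(BU(n); k)`. There is exactly one class with the defining
property (by Borel's computation of `H^*(BU(n); k)`), so that the second branch does not occur. -/
noncomputable def universalChern (k : Type) [CommRing k] (n i : ℕ) :
    Cohomology (BSpace (U n)) k :=
  if h : ∃ c, IsUniversalChernClass k n i c then h.choose else 0

/-! ### Chern classes of representations of finite groups -/

/-- The unitary representation `u : G → U(n)` is isomorphic to the representation `ρ`. -/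
def IsUnitaryForm {G V : Type*} [Group G] [AddCommGroup V] [Module ℂ V]
    (ρ : Representation ℂ G V) {n : ℕ} (u : G →* U n) : Prop :=
  ∃ e : V ≃ₗ[ℂ] (Fin n → ℂ), ∀ g v, e (ρ g v) = Matrix.mulVec (u g).1 (e v)

/-- Every finite-dimensional complex representation of a finite group is isomorphic to a
unitary one. -/
theorem exists_isUnitaryForm {G V : Type*} [Group G] [Finite G] [AddCommGroup V] [Module ℂ V]
    [FiniteDimensional ℂ V] (ρ : Representation ℂ G V) :
    ∃ u : G →* U (Module.finrank ℂ V), IsUnitaryForm ρ u := by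
  classical
  have := Fintype.ofFinite G
  let b := Module.finBasis ℂ V
  let M : G →* Matrix (Fin (Module.finrank ℂ V)) (Fin (Module.finrank ℂ V)) ℂ :=
    (LinearMap.toMatrixAlgEquiv b).toRingEquiv.toMonoidHom.comp ρ
  have hM : ∀ g v, b.equivFun (ρ g v) = (M g).mulVec (b.equivFun v) := fun g v =>
    (LinearMap.toMatrix_mulVec_repr b b (ρ g) v).symm
  have hinv : ∀ g, M g⁻¹ * M g = 1 := fun g => by rw [← map_mul, inv_mul_cancel, map_one]
  obtain ⟨B, hB, hBA⟩ : ∃ B : Matrix (Fin (Module.finrank ℂ V)) (Fin (Module.finrank ℂ V)) ℂ,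
      IsUnit B ∧ ∑ g, star (M g) * M g = star B * B := by
    open scoped ComplexOrder MatrixOrder Matrix.Norms.L2Operator in
    refine CStarAlgebra.isStrictlyPositive_iff_eq_star_mul_self.1
      (Matrix.isStrictlyPositive_iff_posDef.2 ?_)
    refine Matrix.posDef_sum (Finset.univ_nonempty) fun g _ => ?_
    refine Matrix.PosDef.conjTranspose_mul_self _ fun v w h => ?_
    have h' := congrArg (M g⁻¹).mulVec h
    simpa [Matrix.mulVec_mulVec, hinv] using h'
  obtain ⟨B, rfl⟩ := hB
  have hA : ∀ g, star (M g) * (star B.1 * B.1) * M g = star B.1 * B.1 := fun g => by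
    rw [← hBA, Finset.mul_sum, Finset.sum_mul]
    refine Fintype.sum_equiv (Equiv.mulRight g) _ _ fun h => ?_
    simp only [Equiv.coe_mulRight, map_mul, star_mul, mul_assoc]
  have hstar : star (B⁻¹).1 * star B.1 = 1 := by rw [← star_mul, B.mul_inv, star_one]
  let E : (Fin (Module.finrank ℂ V) → ℂ) ≃ₗ[ℂ] (Fin (Module.finrank ℂ V) → ℂ) :=
    LinearEquiv.ofLinearMap (Matrix.mulVecLin B.1) (Matrix.mulVecLin (B⁻¹).1)
      (by rw [← Matrix.mulVecLin_mul, B.mul_inv, Matrix.mulVecLin_one])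
      (by rw [← Matrix.mulVecLin_mul, B.inv_mul, Matrix.mulVecLin_one])
  have hE : ∀ v, E v = B.1.mulVec v := fun _ => rfl
  refine ⟨{ toFun := fun g => ⟨B.1 * M g * (B⁻¹).1, Matrix.mem_unitaryGroup_iff'.2 ?_⟩
            map_one' := ?_
            map_mul' := ?_ }, b.equivFun.trans E, ?_⟩
  · calc star (B.1 * M g * (B⁻¹).1) * (B.1 * M g * (B⁻¹).1)
        = star (B⁻¹).1 * (star (M g) * (star B.1 * B.1) * M g) * (B⁻¹).1 := by
          simp only [star_mul, mul_assoc]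
      _ = 1 := by rw [hA, ← mul_assoc, hstar, one_mul, B.mul_inv]
  · apply Subtype.ext
    simp
  · intro g h
    apply Subtype.ext
    change B.1 * M (g * h) * (B⁻¹).1 = B.1 * M g * (B⁻¹).1 * (B.1 * M h * (B⁻¹).1)
    rw [map_mul]
    simp only [mul_assoc, Units.inv_mul_cancel_left]
  · intro g v
    simp only [LinearEquiv.trans_apply, hM, hE,
      Matrix.mulVec_mulVec, MonoidHom.coe_mk, OneHom.coe_mk, mul_assoc, Units.inv_mul, mul_one]

/-- The `i`-th Chern class `c_i(ρ) = ρ^*(c_i) ∈ H^{2i}(BG; F_p)` of an `n`-dimensional complex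
representation `ρ` of a finite (discrete) group `G`, where `ρ^*` is induced by `BG → BU(n)`
for a unitary form `G → U(n)` of `ρ`. -/
noncomputable def chernClass (p : ℕ) {G : Type} {V : Type*} [Group G] [Finite G]
    [TopologicalSpace G] [DiscreteTopology G] [AddCommGroup V] [Module ℂ V]
    [FiniteDimensional ℂ V] (ρ : Representation ℂ G V) (i : ℕ) :
    Cohomology (BSpace G) (ZMod p) :=
  Cohomology.map (ZMod p) (BSpace.map (exists_isUnitaryForm ρ).choose.toContinuousOfDiscrete)
    (universalChern (ZMod p) (Module.finrank ℂ V) i)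

/-! ### Fusion systems -/

/-- A fusion system on a group `S`: a category whose objects are the subgroups of `S`, whose
morphisms are injective group homomorphisms, which contains all homomorphisms induced by
conjugation in `S`, and in which every morphism is an isomorphism of the category
followed by an inclusion. -/
structure FusionSystem (S : Type) [Group S] where
  /-- the morphisms `P → Q` -/
  Hom : (P Q : Subgroup S) → Set (P →* Q)
  injective_of_mem : ∀ {P Q : Subgroup S} {φ : P →* Q}, φ ∈ Hom P Q → Function.Injective φ
  comp_mem : ∀ {P Q R : Subgroup S} {φ : P →* Q} {ψ : Q →* R},
    φ ∈ Hom P Q → ψ ∈ Hom Q R → ψ.comp φ ∈ Hom P R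
  conj_mem : ∀ {P Q : Subgroup S} (φ : P →* Q) (g : S),
    (∀ x : P, (φ x : S) = g * x * g⁻¹) → φ ∈ Hom P Q
  exists_factor : ∀ {P Q : Subgroup S} {φ : P →* Q}, φ ∈ Hom P Q →
    ∃ (R : Subgroup S) (h : R ≤ Q) (e : P ≃* R), e.toMonoidHom ∈ Hom P R ∧
      e.symm.toMonoidHom ∈ Hom R P ∧ φ = (Subgroup.inclusion h).comp e.toMonoidHom

namespace FusionSystem

variable {S : Type} [Group S] (F : FusionSystem S)

/-- The group `Aut_F(P)`. -/
def autF (P : Subgroup S) : Subgroup (MulAut P) where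
  carrier := {α | α.toMonoidHom ∈ F.Hom P P}
  one_mem' := F.conj_mem _ 1 fun x => by simp
  mul_mem' := fun {a b} ha hb => F.comp_mem (φ := b.toMonoidHom) (ψ := a.toMonoidHom) hb ha
  inv_mem' := fun {a} ha => by
    obtain ⟨R, hR, e, -, he, hφ⟩ := F.exists_factor ha
    have hval : ∀ x : P, (a x : S) = e x := fun x => congrArg Subtype.val (DFunLike.congr_fun hφ x)
    obtain rfl : R = P := le_antisymm hR fun x hx => by
      have h := hval (a.symm ⟨x, hx⟩)
      rw [MulEquiv.apply_symm_apply] at h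
      change x = _ at h
      rw [h]
      exact (e _).2
    obtain rfl : a = e := MulEquiv.ext fun x => Subtype.ext (hval x)
    exact he

/-- The group `Aut_S(P)` of automorphisms of `P` induced by conjugation with elements
of the normalizer of `P` in `S`. -/
def autS (P : Subgroup S) : Subgroup (MulAut P) := P.normalizerMonoidHom.range

/-- `P` is fully automized: `Aut_S(P)` is a Sylow `p`-subgroup of `Aut_F(P)`. -/
def IsFullyAutomized (p : ℕ) (P : Subgroup S) : Prop :=
  autS P ≤ F.autF P ∧ ∃ T : Sylow p (F.autF P), (T : Subgroup (F.autF P)) =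
    (autS P).subgroupOf (F.autF P)

/-- The subgroup `N_φ` of `S`, for an isomorphism `φ : Q → P`: the set of `g ∈ N_S(Q)` such that
`φ ∘ c_g ∘ φ⁻¹ ∈ Aut_S(P)`. -/
def extender {P Q : Subgroup S} (φ : Q ≃* P) : Subgroup S :=
  (((autS P).comap (MulAut.congr φ).toMonoidHom).comap Q.normalizerMonoidHom).map
    (Subgroup.normalizer (Q : Set S)).subtype

/-- `P` is receptive: every isomorphism `φ : Q → P` in `F` extends to a morphism `N_φ → S` in `F`
(the condition `h` says that `x ∈ Q` lies in `N_φ`, which always holds). -/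
def IsReceptive (P : Subgroup S) : Prop :=
  ∀ (Q : Subgroup S) (φ : Q ≃* P), φ.toMonoidHom ∈ F.Hom Q P →
    ∃ ψ ∈ F.Hom (extender φ) ⊤, ∀ (x : S) (hx : x ∈ Q) (h : x ∈ extender φ),
      (ψ ⟨x, h⟩ : S) = φ ⟨x, hx⟩

/-- `F` is saturated: every subgroup of `S` is `F`-conjugate to one that is fully automized
and receptive. -/
def IsSaturated (p : ℕ) : Prop :=
  ∀ P : Subgroup S, ∃ (Q : Subgroup S) (φ : P ≃* Q), φ.toMonoidHom ∈ F.Hom P Q ∧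
    F.IsFullyAutomized p Q ∧ F.IsReceptive Q

/-- `P` is `F`-centric: `C_S(φ(P)) ≤ φ(P)` for all `φ ∈ Hom_F(P, S)`. -/
def IsCentric (P : Subgroup S) : Prop :=
  ∀ φ ∈ F.Hom P ⊤, Subgroup.centralizer (φ.range.map (⊤ : Subgroup S).subtype : Set S) ≤
    φ.range.map (⊤ : Subgroup S).subtype

/-- A representation `ρ` of `S` is `F`-fusion-preserving: for all `P ≤ S` and `φ ∈ Hom_F(P, S)` the
representations `ρ|_P` and `ρ ∘ φ` of `P` are isomorphic. -/
def IsFusionPreserving {V : Type*} [AddCommGroup V] [Module ℂ V] (ρ : Representation ℂ S V) :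
    Prop :=
  ∀ (P : Subgroup S), ∀ φ ∈ F.Hom P ⊤, ∃ e : V ≃ₗ[ℂ] V,
    ∀ (x : P) (v : V), e (ρ x v) = ρ (φ x : S) (e v)

section Cohomology

variable [TopologicalSpace S] [DiscreteTopology S]

/-- The restriction `H^*(S; k) → H^*(P; k)`. -/
noncomputable def res (k : Type) [CommRing k] (P : Subgroup S) :
    Cohomology (BSpace S) k →+* Cohomology (BSpace P) k :=
  Cohomology.map k (BSpace.map P.subtype.toContinuousOfDiscrete)

/-- The elements `x ∈ H^*(S; k)` whose restrictions to the subgroups in `D` form a compatible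
family with respect to all morphisms of `F` between members of `D`, i.e. the preimage of the inverse
limit of the `H^*(P; k)`, `P ∈ D`, under the restriction maps. (Inner automorphisms act trivially
on cohomology, so the limit may equally be formed over the orbit category.) -/
noncomputable def stableElements (k : Type) [CommRing k] (D : Set (Subgroup S)) :
    Subring (Cohomology (BSpace S) k) :=
  ⨅ (P ∈ D) (Q ∈ D) (φ ∈ F.Hom P Q),
    RingHom.eqLocus ((Cohomology.map k (BSpace.map (MonoidHom.toContinuousOfDiscrete φ))).comp
      (res k Q)) (res k P)

/-- The cohomology ring `H^*(F; k) ⊆ H^*(S; k)` of `F`, defined by the limit over the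
`F`-centric subgroups. -/
noncomputable def cohomology (k : Type) [CommRing k] : Subring (Cohomology (BSpace S) k) :=
  F.stableElements k {P | F.IsCentric P}

/-- The degree `m` part `H^m(F; k) ⊆ H^m(S; k)`. -/
noncomputable def cohomologyDegree (k : Type) [CommRing k] (m : ℕ) :
    AddSubgroup (Cohomology (BSpace S) k) :=
  (F.cohomology k).toAddSubgroup ⊓ Cohomology.degree (BSpace S) k m

/-- The Chern subring `Ch(F)`: the subring of `H^*(S; F_p)` generated by the Chern classes of all
`F`-fusion-preserving complex representations of `S`. -/
noncomputable def chernSubring [Finite S] (p : ℕ) : Subring (Cohomology (BSpace S) (ZMod p)) :=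
  Subring.closure {y | ∃ (n : ℕ) (ρ : Representation ℂ S (Fin n → ℂ)) (i : ℕ),
    F.IsFusionPreserving ρ ∧ y = chernClass p ρ i}

end Cohomology
end FusionSystem

/-!
Let `ρ` be a fusion-preserving representation of `S`, with unitary form `u : S → U(n)`, and let
`φ : P → Q` be a morphism of `F`. Then `u|_P` and `u ∘ φ` are isomorphic unitary representations of
`P`. The unitary part of the polar decomposition of an isomorphism is again an intertwiner
(`exists_unitary_conj_of_intertwining`), so they are conjugate by an element `w` of `U(n)`.

Conjugate homomorphisms `f` and `w f w⁻¹` induce homotopic maps of classifying spaces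
(`BSpace.conjHomotopy`), hence the same map on cohomology, by the homotopy invariance of cohomology
(`Cohomology.map_eq_of_homotopy`), which is deduced from Mathlib's chain homotopies by duality.
Therefore `φ^*(u^*(c)|_Q) = u^*(c)|_P` for every class `c` of `BU(n)`
(`FusionSystem.IsFusionPreserving.map_mem_stableElements`), and in particular for the universal
Chern classes. The stable elements form a subring, so it contains the subring generated by all
Chern classes; stability for all subgroups of `S` implies stability for the `F`-centric ones.
-/

/-! ### Chain homotopies act on cochains -/

namespace Cochain

variable {X Y : SSet.{0}} {k : Type} [CommRing k]

/-- A cochain in degree `n`, as a linear form on Mathlib's module of `n`-chains `⨁_{X_n} k`. It is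
obtained from the universal property of the coproduct, so that it works with Mathlib's chain
homotopies directly. -/
noncomputable def toHom (f : Cochain X k) (n : ℕ) :
    (X.chainComplex (ModuleCat.of k k)).X n ⟶ ModuleCat.of k k :=
  Limits.Cofan.IsColimit.desc (X.isColimitChainComplexXCofan (ModuleCat.of k k) n)
    fun x => f n x • 𝟙 _

theorem ι_toHom (f : Cochain X k) (n : ℕ) (x : X _⦋n⦌) :
    X.ιChainComplex x ≫ f.toHom n = f n x • 𝟙 (ModuleCat.of k k) :=
  Limits.Cofan.IsColimit.fac (X.isColimitChainComplexXCofan (ModuleCat.of k k) n) _ x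

theorem smul_id_injective : Function.Injective fun a : k => a • 𝟙 (ModuleCat.of k k) := by
  intro a b h
  have := congrArg (fun F : ModuleCat.of k k ⟶ ModuleCat.of k k => F.hom (1 : k)) h
  simpa using this

theorem d_toHom (f : Cochain X k) (n : ℕ) :
    (X.chainComplex (ModuleCat.of k k)).d (n + 1) n ≫ f.toHom n = (d f).toHom (n + 1) := by
  refine SSet.chainComplex_hom_ext fun x => ?_
  rw [SSet.ιChainComplex_d_assoc, ι_toHom, d_succ, Preadditive.sum_comp, Finset.sum_smul]
  refine Finset.sum_congr rfl fun i _ => ?_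
  rw [Preadditive.zsmul_comp, ι_toHom, mul_smul, ← Int.cast_smul_eq_zsmul k]
  simp

theorem map_toHom (φ : X ⟶ Y) (f : Cochain Y k) (n : ℕ) :
    (SSet.chainComplexMap φ (ModuleCat.of k k)).f n ≫ f.toHom n = (comap k φ f).toHom n := by
  refine SSet.chainComplex_hom_ext fun x => ?_
  rw [SSet.ι_chainComplexMap_f_assoc, ι_toHom, ι_toHom]
  rfl

theorem toHom_add (f g : Cochain X k) (n : ℕ) : (f + g).toHom n = f.toHom n + g.toHom n := by
  refine SSet.chainComplex_hom_ext fun x => ?_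
  rw [Preadditive.comp_add, ι_toHom, ι_toHom, ι_toHom, add_apply, add_smul]

theorem ext_toHom {f g : Cochain X k} (h : ∀ n, f.toHom n = g.toHom n) : f = g := by
  ext n x
  apply smul_id_injective
  simp only [← ι_toHom, h]

/-- The operator on cochains dual to a chain homotopy `h`, that is, precomposition with
`h : C_n(X) → C_{n+1}(Y)`; it lowers degrees by one. -/
noncomputable def homotopyOperator {φ ψ : X ⟶ Y}
    (h : Homotopy (SSet.chainComplexMap φ (ModuleCat.of k k)) (SSet.chainComplexMap ψ _))
    (f : Cochain Y k) : Cochain X k :=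
  ⟨fun n x => (X.ιChainComplex x ≫ h.hom n (n + 1) ≫ f.toHom (n + 1)).hom (1 : k)⟩

theorem homotopyOperator_toHom {φ ψ : X ⟶ Y}
    (h : Homotopy (SSet.chainComplexMap φ (ModuleCat.of k k)) (SSet.chainComplexMap ψ _))
    (f : Cochain Y k) (n : ℕ) :
    (homotopyOperator h f).toHom n = h.hom n (n + 1) ≫ f.toHom (n + 1) := by
  refine SSet.chainComplex_hom_ext fun x => ?_
  rw [ι_toHom]
  apply ModuleCat.hom_ext
  apply LinearMap.ext_ring
  simp [homotopyOperator]

theorem IsFinite.homotopyOperator {φ ψ : X ⟶ Y}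
    (h : Homotopy (SSet.chainComplexMap φ (ModuleCat.of k k)) (SSet.chainComplexMap ψ _))
    {f : Cochain Y k} (hf : f.IsFinite) : (homotopyOperator h f).IsFinite := by
  obtain ⟨N, hN⟩ := hf
  refine ⟨N, fun n hn x => ?_⟩
  have : f.toHom (n + 1) = 0 := SSet.chainComplex_hom_ext fun y => by
    rw [ι_toHom, hN _ (by omega), zero_smul, Limits.comp_zero]
  simp [Cochain.homotopyOperator, this]

/-- On cocycles, the homotopy formula `φ^* - ψ^* = dK + Kd` reduces to `φ^* - ψ^* = dK`. -/
theorem comap_eq_add_d_homotopyOperator {φ ψ : X ⟶ Y}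
    (h : Homotopy (SSet.chainComplexMap φ (ModuleCat.of k k)) (SSet.chainComplexMap ψ _))
    {f : Cochain Y k} (hf : d f = 0) :
    comap k φ f = d (homotopyOperator h f) + comap k ψ f := by
  refine ext_toHom fun n => ?_
  have hd : ∀ m, (Y.chainComplex (ModuleCat.of k k)).d (m + 1) m ≫ f.toHom m = 0 := fun m => by
    refine SSet.chainComplex_hom_ext fun y => ?_
    rw [d_toHom, hf, ι_toHom, zero_apply, zero_smul, Limits.comp_zero]
  rw [toHom_add, ← map_toHom, ← map_toHom, h.comm n, Preadditive.add_comp, Preadditive.add_comp,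
    prevD_eq (j' := n + 1) (w := by simp), Category.assoc, hd, Limits.comp_zero, add_zero]
  congr 1
  cases n with
  | zero =>
    rw [dNext_eq_zero _ _ (by simp), Limits.zero_comp]
    refine (SSet.chainComplex_hom_ext fun x => ?_).symm
    rw [ι_toHom, d_zero, zero_smul, Limits.comp_zero]
  | succ m =>
    rw [dNext_eq (i' := m) (w := by simp), Category.assoc, ← homotopyOperator_toHom, d_toHom]

end Cochain

/-! ### Functoriality and homotopy invariance of cohomology -/

namespace Cohomology

variable {X Y Z : SSet.{0}} {k : Type} [CommRing k]

theorem mk_surjective : Function.Surjective (mk (X := X) (k := k)) :=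
  (Cochain.cobRel X k).mk'_surjective

theorem map_comp (φ : X ⟶ Y) (ψ : Y ⟶ Z) : map k (φ ≫ ψ) = (map k φ).comp (map k ψ) := by
  refine RingHom.ext fun x => ?_
  obtain ⟨z, rfl⟩ := mk_surjective x
  rfl

theorem map_mem_degree (φ : X ⟶ Y) {n : ℕ} {x : Cohomology Y k} (hx : x ∈ degree Y k n) :
    map k φ x ∈ degree X k n := by
  obtain ⟨z, hz, rfl⟩ := hx
  exact ⟨Cochain.comapCocycles k φ z, fun m hm s => hz m hm _, rfl⟩

theorem map_eq_of_homotopy {φ ψ : X ⟶ Y} (h : SSet.Homotopy φ ψ) : map k φ = map k ψ := by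
  refine RingHom.ext fun x => ?_
  obtain ⟨z, rfl⟩ := mk_surjective x
  let H := h.chainComplexMap (ModuleCat.of k k)
  exact (RingCon.eq _).2 ⟨Cochain.homotopyOperator H z.1, z.2.2.homotopyOperator H,
    eq_sub_of_add_eq (Cochain.comap_eq_add_d_homotopyOperator H z.2.1).symm⟩

end Cohomology

/-! ### Conjugate homomorphisms and classifying spaces -/

namespace BSpace

variable {G H K : Type} [Group G] [TopologicalSpace G] [IsTopologicalGroup G]
  [Group H] [TopologicalSpace H] [IsTopologicalGroup H]
  [Group K] [TopologicalSpace K] [IsTopologicalGroup K]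

theorem map_comp (f : G →ₜ* H) (g : H →ₜ* K) : map (g.comp f) = map f ≫ map g := by
  ext n x
  induction x using Quotient.inductionOn with | _ σ
  rfl

/-- If `g = w f w⁻¹` for some `w : H`, then `Bf` and `Bg` are homotopic. The homotopy multiplies the
entry `f σ_i` by `w⁻¹` on the right if the vertex `i` lies over the end point `1` of `Δ[1]`. Over
that end point one finds `[(f σ_i w⁻¹)_i]`, which is `[(w f σ_i w⁻¹)_i]` because simplices are
orbits under left translation. No path from `1` to `w` is needed. -/
noncomputable def conjHomotopy (f g : G →ₜ* H) (w : H) (hw : ∀ x, g x = w * f x * w⁻¹) :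
    SSet.Homotopy (map f) (map g) where
  h :=
    { app n := ↾fun x => Quotient.map (fun σ i => f.toContinuousMap.comp (σ i) *
          ContinuousMap.const _ (if x.2.1.toOrderHom i = 0 then 1 else w⁻¹)) (by
          rintro _ σ ⟨γ, rfl⟩
          exact ⟨f.toContinuousMap.comp γ, funext fun i => ContinuousMap.ext fun t => by
            simp [mul_assoc]⟩) x.1
      naturality n m θ := by
        ext ⟨x, y⟩
        induction x using Quotient.inductionOn with | _ σ
        rfl }
  h₀ := by
    ext n x
    induction x using Quotient.inductionOn with | _ σ
    exact congrArg (Quotient.mk _) (funext fun i => mul_one _)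
  h₁ := by
    ext n x
    induction x using Quotient.inductionOn with | _ σ
    refine Eq.symm (Quotient.sound ?_)
    refine ⟨ContinuousMap.const _ w, funext fun i => ContinuousMap.ext fun t => ?_⟩
    change w * (f (σ i t) * w⁻¹) = g (σ i t)
    rw [hw, mul_assoc]
  rel := by
    ext n x
    exact x.1.2.elim

/-- Conjugate homomorphisms induce the same map on the cohomology of classifying spaces. -/
theorem cohomologyMap_eq_of_conj (k : Type) [CommRing k] (f g : G →ₜ* H) (w : H)
    (hw : ∀ x, g x = w * f x * w⁻¹) : Cohomology.map k (map f) = Cohomology.map k (map g) :=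
  Cohomology.map_eq_of_homotopy (conjHomotopy f g w hw)

end BSpace

/-! ### Isomorphic unitary representations are unitarily equivalent -/

/-- If an invertible `a` intertwines two unitary representations `u` and `v`, then so does its
unitary part `w = a |a|⁻¹` in the polar decomposition: `|a|² = a* a` commutes with `u`,
hence so does its positive square root `|a|`. -/
theorem exists_unitary_conj_of_intertwining {G A : Type*} [Group G] [CStarAlgebra A]
    [PartialOrder A] [StarOrderedRing A] (u v : G →* unitary A) (a : Aˣ)
    (h : ∀ x, a.1 * u x = v x * a.1) :
    ∃ w : unitary A, ∀ x, v x = w * u x * w⁻¹ := by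
  have hstar : ∀ x, (u x : A) * star a.1 = star a.1 * v x := fun x => by
    -- The adjoint of the relation for `x⁻¹`, as `u x⁻¹` and `v x⁻¹` are the adjoints of
    -- `u x` and `v x`.
    have := congrArg star (h x⁻¹)
    rw [star_mul, star_mul, map_inv, map_inv, ← Unitary.star_eq_inv, ← Unitary.star_eq_inv] at this
    simpa using this
  obtain ⟨s, hs⟩ : IsUnit (CFC.sqrt (star a.1 * a.1)) :=
    (CFC.isUnit_sqrt_iff _ (star_mul_self_nonneg a.1)).2 (a.isUnit.star.mul a.isUnit)
  have hss : s.1 * s.1 = star a.1 * a.1 := by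
    rw [hs, CFC.sqrt_mul_sqrt_self _ (star_mul_self_nonneg a.1)]
  have hsa : star s.1 = s.1 := by
    rw [hs]
    exact (CFC.sqrt_nonneg _).isSelfAdjoint
  have hcomm : ∀ x, Commute s.1 (u x : A) := fun x => by
    rw [hs, CFC.sqrt_eq_cfc]
    refine Commute.cfc_nnreal ?_ _
    change star a.1 * a.1 * u x = u x * (star a.1 * a.1)
    rw [mul_assoc, h, ← mul_assoc, ← hstar, mul_assoc]
  have hw : (a * s⁻¹).1 ∈ unitary A := by
    refine IsUnit.mem_unitary_of_star_mul_self (a * s⁻¹).isUnit ?_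
    calc star (a * s⁻¹).1 * (a * s⁻¹).1
        = star s⁻¹.1 * (star a.1 * a.1) * s⁻¹.1 := by
          simp only [Units.val_mul, star_mul, mul_assoc]
      _ = star (s.1 * s⁻¹.1) := by
          rw [← hss, star_mul, hsa, ← mul_assoc, mul_assoc, s.mul_inv, mul_one]
      _ = 1 := by rw [s.mul_inv, star_one]
  refine ⟨⟨_, hw⟩, fun x => eq_mul_inv_of_mul_eq (Subtype.ext ?_)⟩
  change (v x : A) * (a * s⁻¹).1 = (a * s⁻¹).1 * u x
  rw [Units.val_mul, ← mul_assoc, ← h, mul_assoc, mul_assoc, (hcomm x).units_inv_left.eq]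

open scoped ComplexOrder MatrixOrder Matrix.Norms.L2Operator in
theorem IsUnitaryForm.exists_conj {G V W : Type*} [Group G] [AddCommGroup V] [Module ℂ V]
    [AddCommGroup W] [Module ℂ W] {ρ : Representation ℂ G V} {τ : Representation ℂ G W} {n : ℕ}
    {u v : G →* U n} (hu : IsUnitaryForm ρ u) (hv : IsUnitaryForm τ v) (e : V ≃ₗ[ℂ] W)
    (he : ∀ g x, e (ρ g x) = τ g (e x)) :
    ∃ w : U n, ∀ g, v g = w * u g * w⁻¹ := by
  obtain ⟨a, ha⟩ := hu
  obtain ⟨b, hb⟩ := hv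
  let T := (a.symm.trans e).trans b
  have hT : ∀ g y, T (Matrix.mulVec (u g).1 y) = Matrix.mulVec (v g).1 (T y) := fun g y => by
    obtain ⟨x, rfl⟩ := a.surjective y
    simp [T, ← ha, ← hb, he]
  let M : (Matrix (Fin n) (Fin n) ℂ)ˣ :=
    Units.map LinearMap.toMatrixAlgEquiv'.toRingEquiv.toMonoidHom
      (LinearMap.GeneralLinearGroup.ofLinearEquiv T)
  refine exists_unitary_conj_of_intertwining u v M fun g => ?_
  apply Matrix.mulVec_injective
  funext y
  have hM : ∀ y, Matrix.mulVec M.1 y = T y := fun y => LinearMap.toMatrix'_mulVec _ y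
  rw [← Matrix.mulVec_mulVec, ← Matrix.mulVec_mulVec, hM, hM, hT]

/-! ### Chern classes of fusion-preserving representations -/

theorem universalChern_mem_degree (k : Type) [CommRing k] (n i : ℕ) :
    universalChern k n i ∈ Cohomology.degree (BSpace (U n)) k (2 * i) := by
  rw [universalChern]
  split_ifs with h
  · exact h.choose_spec.1
  · -- The default value `0` lies in every degree, so that the existence of Chern classes plays
    -- no role here.
    exact zero_mem _

theorem chernClass_mem_degree (p : ℕ) {G : Type} {V : Type*} [Group G] [Finite G]
    [TopologicalSpace G] [DiscreteTopology G] [AddCommGroup V] [Module ℂ V]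
    [FiniteDimensional ℂ V] (ρ : Representation ℂ G V) (i : ℕ) :
    chernClass p ρ i ∈ Cohomology.degree (BSpace G) (ZMod p) (2 * i) :=
  Cohomology.map_mem_degree _ (universalChern_mem_degree _ _ _)

namespace FusionSystem

variable {S : Type} [Group S] (F : FusionSystem S)

theorem subtype_comp_mem {P Q : Subgroup S} {φ : P →* Q} (hφ : φ ∈ F.Hom P Q) :
    (Subgroup.inclusion (le_top : Q ≤ ⊤)).comp φ ∈ F.Hom P ⊤ :=
  F.comp_mem hφ (F.conj_mem _ 1 fun _ => by simp)

variable [TopologicalSpace S] [DiscreteTopology S]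

theorem mem_stableElements {k : Type} [CommRing k] {D : Set (Subgroup S)}
    {x : Cohomology (BSpace S) k} :
    x ∈ F.stableElements k D ↔ ∀ P ∈ D, ∀ Q ∈ D, ∀ φ ∈ F.Hom P Q,
      Cohomology.map k (BSpace.map (MonoidHom.toContinuousOfDiscrete φ)) (res k Q x) =
        res k P x := by
  simp only [stableElements, Subring.mem_iInf]
  rfl

theorem stableElements_anti (k : Type) [CommRing k] {D E : Set (Subgroup S)} (h : D ⊆ E) :
    F.stableElements k E ≤ F.stableElements k D := fun x hx =>
  F.mem_stableElements.2 fun P hP Q hQ => F.mem_stableElements.1 hx P (h hP) Q (h hQ)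

/-- The pullback of any class of `BU(n)` along a unitary form `u` of a fusion-preserving
representation is stable. For `φ : P → Q` in `F`, the unitary representations `u|_P` and `u ∘ φ` of
`P` are isomorphic, hence conjugate in `U(n)`, hence induce the same map
on cohomology. -/
theorem IsFusionPreserving.map_mem_stableElements {F : FusionSystem S} {k : Type} [CommRing k]
    {V : Type*} [AddCommGroup V] [Module ℂ V] {ρ : Representation ℂ S V}
    (hρ : F.IsFusionPreserving ρ) {n : ℕ} {u : S →* U n} (hu : IsUnitaryForm ρ u)
    (c : Cohomology (BSpace (U n)) k) :
    Cohomology.map k (BSpace.map u.toContinuousOfDiscrete) c ∈ F.stableElements k Set.univ := by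
  refine F.mem_stableElements.2 fun P _ Q _ φ hφ => ?_
  obtain ⟨e, he⟩ := hρ P _ (F.subtype_comp_mem hφ)
  obtain ⟨a, ha⟩ := hu
  obtain ⟨w, hw⟩ := IsUnitaryForm.exists_conj (ρ := ρ.comp P.subtype)
    (τ := ρ.comp (Q.subtype.comp φ)) (u := u.comp P.subtype) (v := u.comp (Q.subtype.comp φ))
    ⟨a, fun x v => ha x v⟩ ⟨a, fun x v => ha _ v⟩ e he
  rw [res, res, ← RingHom.comp_apply, ← RingHom.comp_apply, ← RingHom.comp_apply,
    ← Cohomology.map_comp, ← Cohomology.map_comp, ← Cohomology.map_comp, ← BSpace.map_comp,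
    ← BSpace.map_comp, ← BSpace.map_comp]
  exact (DFunLike.congr_fun (BSpace.cohomologyMap_eq_of_conj k _ _ w hw) c).symm

theorem IsFusionPreserving.chernClass_mem_stableElements [Finite S] {F : FusionSystem S} (p : ℕ)
    {V : Type*} [AddCommGroup V] [Module ℂ V] [FiniteDimensional ℂ V] {ρ : Representation ℂ S V}
    (hρ : F.IsFusionPreserving ρ) (i : ℕ) :
    chernClass p ρ i ∈ F.stableElements (ZMod p) Set.univ :=
  hρ.map_mem_stableElements (exists_isUnitaryForm ρ).choose_spec _

end FusionSystem

theorem propositionp (p : ℕ) [Fact p.Prime] (S : Type) [Group S] [Finite S]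
    [TopologicalSpace S] [DiscreteTopology S] (hS : IsPGroup p S)
    (F : FusionSystem S) (hF : F.IsSaturated p) :
    (∀ (V : Type*) [AddCommGroup V] [Module ℂ V] [FiniteDimensional ℂ V]
      (ρ : Representation ℂ S V), F.IsFusionPreserving ρ →
      ∀ i : ℕ, chernClass p ρ i ∈ F.cohomologyDegree (ZMod p) (2 * i)) ∧
    F.chernSubring p ≤ F.cohomology (ZMod p) ∧
    F.chernSubring p ≤ F.stableElements (ZMod p) Set.univ := by
  have hanti : F.stableElements (ZMod p) Set.univ ≤ F.cohomology (ZMod p) :=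
    F.stableElements_anti _ (Set.subset_univ _)
  have hCh : F.chernSubring p ≤ F.stableElements (ZMod p) Set.univ := by
    refine (Subring.closure_le).2 ?_
    rintro _ ⟨n, ρ, i, hρ, rfl⟩
    exact hρ.chernClass_mem_stableElements p i
  exact ⟨fun V _ _ _ ρ hρ i =>
    ⟨hanti (hρ.chernClass_mem_stableElements p i), chernClass_mem_degree p ρ i⟩,
    hCh.trans hanti, hCh⟩
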